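/- Let $G_1$ and $G_2$ be locally compact (Hausdorff) groups. A weight on a locally compact group $G$ is a continuous function $\omega: G\to(0,\infty)$ with $\omega(xy)\le\omega(x)\omega(y)$ for all $x,y\in G$; it is bounded away from zero if there is $\delta>0$ with $\omega(x)\ge\delta$ for all $x\in G$. The Beurling algebra $L^1(G,\omega)$ is the complex Banach algebra of (classes of) measurable functions $f:G\to\mathbb{C}$ with $\|f\|_\omega=\int_G|f(x)|\,\omega(x)\,dx<\infty$, where $dx$ is a left Haar measure, with the convolution product $(f*g)(x)=\int_G f(y)\,g(y^{-1}x)\,dy$. A Banach algebra $A$ is weakly amenable if every continuous derivation $D:A\to A^*$, i.e. every continuous linear map with $D(ab)=a\cdot D(b)+D(a)\cdot b$ $(a,b\in A)$, is inner, i.e. of the form $D(a)=a\cdot\varphi-\varphi\cdot a$ for some $\varphi\in A^*$; here $\langle x,a\cdot\varphi\rangle=\langle xa,\varphi\rangle$ and $\langle x,\varphi\cdot a\rangle=\langle ax,\varphi\rangle$. Let $\omega_i$ be a weight on $G_i$ that is bounded away from zero $(i=1,2)$, and let $\omega_1\times\omega_2$ be the weight $(\omega_1\times\omega_2)(x_1,x_2)=\omega_1(x_1)\,\omega_2(x_2)$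 on $G_1\times G_2$. If $L^1(G_1\times G_2,\omega_1\times\omega_2)$ is weakly amenable, then both $L^1(G_1,\omega_1)$ and $L^1(G_2,\omega_2)$ are weakly amenable. -/

import Mathlib

namespace Beurling

open MeasureTheory Filter Topology
open scoped ENNReal NNReal

/-- A weight on a group: a continuous, strictly positive, submultiplicative real function. -/
structure Weight (G : Type*) [Mul G] [TopologicalSpace G] where
  toFun : G → ℝ
  continuous_toFun : Continuous toFun
  pos : ∀ x, 0 < toFun x
  mul_le : ∀ x y, toFun (x * y) ≤ toFun x * toFun y

namespace Weight

instance {G : Type*} [Mul G] [TopologicalSpace G] : CoeFun (Weight G) fun _ => G → ℝ := ⟨toFun⟩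

/-- The weight `(ω₁ × ω₂)(x₁, x₂) = ω₁(x₁) ω₂(x₂)` on the product group. -/
def prod {G₁ G₂ : Type*} [Mul G₁] [TopologicalSpace G₁] [Mul G₂] [TopologicalSpace G₂]
    (ω₁ : Weight G₁) (ω₂ : Weight G₂) : Weight (G₁ × G₂) where
  toFun x := ω₁ x.1 * ω₂ x.2
  continuous_toFun := (ω₁.continuous_toFun.comp continuous_fst).mul
    (ω₂.continuous_toFun.comp continuous_snd)
  pos x := mul_pos (ω₁.pos _) (ω₂.pos _)
  mul_le x y := by
    calc ω₁ (x.1 * y.1) * ω₂ (x.2 * y.2) ≤ (ω₁ x.1 * ω₁ y.1) * (ω₂ x.2 * ω₂ y.2) :=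
          mul_le_mul (ω₁.mul_le _ _) (ω₂.mul_le _ _) (ω₂.pos _).le
            (mul_pos (ω₁.pos _) (ω₁.pos _)).le
      _ = (ω₁ x.1 * ω₂ x.2) * (ω₁ y.1 * ω₂ y.2) := by ring

/-- The weight is bounded away from zero: it has a positive lower bound. -/
def BoundedAwayFromZero {G : Type*} [Mul G] [TopologicalSpace G] (ω : Weight G) : Prop :=
  ∃ δ : ℝ, 0 < δ ∧ ∀ x, δ ≤ ω x

end Weight

section Generic
set_option linter.unusedSectionVars false
variable {G : Type*} [Group G] [TopologicalSpace G] [IsTopologicalGroup G] [LocallyCompactSpace G]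
  [T2Space G] [MeasurableSpace G] [BorelSpace G]

theorem continuous_modular : Continuous (Measure.modularCharacterFun : G → ℝ≥0) := by
  let μ : Measure G := Measure.haar
  obtain ⟨⟨f, f_cont⟩, f_comp, f_nonneg, f_one⟩ :
    ∃ f : C(G, ℝ), HasCompactSupport f ∧ 0 ≤ f ∧ f 1 ≠ 0 := exists_continuous_nonneg_pos 1
  have hne : ∫ x, f x ∂μ ≠ 0 :=
    ne_of_gt (f_cont.integral_pos_of_hasCompactSupport_nonneg_nonzero f_comp f_nonneg f_one)
  have key : ∀ g : G, (Measure.modularCharacterFun g : ℝ)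
      = (∫ y, f (y⁻¹ * g) ∂μ.inv) / ∫ x, f x ∂μ := by
    intro g
    rw [Measure.modularCharacterFun_eq_haarScalarFactor μ g,
      Measure.haarScalarFactor_eq_integral_div _ _ f_cont f_comp hne,
      integral_map (by fun_prop) f_cont.aestronglyMeasurable, Measure.inv_def,
      integral_map measurable_inv.aemeasurable
        (Continuous.aestronglyMeasurable (by fun_prop : Continuous fun y : G => f (y⁻¹ * g)))]
    simp
  rw [NNReal.isEmbedding_coe.continuous_iff]
  have : ((↑) : ℝ≥0 → ℝ) ∘ (Measure.modularCharacterFun : G → ℝ≥0)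
      = fun g => (∫ y, f (y⁻¹ * g) ∂μ.inv) / ∫ x, f x ∂μ := funext key
  rw [this]
  exact (continuous_integral_apply_inv_mul f_cont f_comp).div_const _

variable (μ : Measure G) [μ.IsHaarMeasure] [μ.Regular]

theorem null_inv_of_isCompact {N K : Set G} (hN : μ N = 0) (hK : IsCompact K) :
    μ {y ∈ K | y⁻¹ ∈ N} = 0 := by
  let δ : G → ℝ≥0∞ := fun x => ((Measure.modularCharacterFun x)⁻¹ : ℝ≥0)
  have hΔ : ∀ x : G, Measure.modularCharacterFun x ≠ 0 := fun x =>
    (Measure.modularCharacterFun_pos x).ne'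
  have hc : Continuous (fun x : G => (Measure.modularCharacterFun x)⁻¹) :=
    continuous_modular.inv₀ hΔ
  have hδm : Measurable δ := hc.measurable.coe_nnreal_ennreal
  let μ' : Measure G := μ.inv.withDensity δ
  have hmap : ∀ g : G, Measure.map (· * g) μ = Measure.modularCharacterFun g • μ := by
    intro g
    have : (Measure.map (· * g) μ).Regular := Measure.Regular.map (Homeomorph.mulRight g)
    rw [Measure.modularCharacterFun_eq_haarScalarFactor μ g]
    exact Measure.isMulLeftInvariant_eq_smul_of_regular _ μ
  have hl : ∀ F : G → ℝ≥0∞, Measurable F → ∫⁻ x, F x ∂μ' = ∫⁻ x, δ x⁻¹ * F x⁻¹ ∂μ := by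
    intro F hF
    rw [lintegral_withDensity_eq_lintegral_mul _ hδm hF, Measure.inv_def,
      lintegral_map (hδm.mul hF) measurable_inv]
    rfl
  have hinv : μ'.IsMulLeftInvariant := by
    refine ⟨fun g => Measure.ext fun s hs => ?_⟩
    have hF : Measurable (s.indicator (1 : G → ℝ≥0∞)) := measurable_one.indicator hs
    rw [← lintegral_indicator_one hs, ← lintegral_indicator_one hs,
      lintegral_map hF (measurable_const_mul g), hl (fun x => s.indicator 1 (g * x)) (hF.comp (measurable_const_mul g)), hl _ hF]
    have h1 : ∀ x : G, δ x⁻¹ * s.indicator (1 : G → ℝ≥0∞) (g * x⁻¹)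
        = δ g⁻¹ * (δ (x * g⁻¹)⁻¹ * s.indicator (1 : G → ℝ≥0∞) (x * g⁻¹)⁻¹) := by
      intro x
      rw [← mul_assoc]
      congr 1
      · simp only [δ]
        rw [← ENNReal.coe_mul, ← mul_inv, ← Measure.modularCharacterFun_map_mul]
        simp
      · simp
    simp_rw [h1]
    rw [lintegral_const_mul' _ _ (by simp [δ])]
    have h2 : Measurable fun t : G => δ t⁻¹ * s.indicator (1 : G → ℝ≥0∞) t⁻¹ :=
      (hδm.comp measurable_inv).mul (hF.comp measurable_inv)
    rw [← lintegral_map (μ := μ) h2 (measurable_mul_const g⁻¹), hmap,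
      show ∀ (c : ℝ≥0), c • μ = (c : ℝ≥0∞) • μ from fun _ => rfl, lintegral_smul_measure, smul_eq_mul, ← mul_assoc]
    simp only [δ]
    rw [← ENNReal.coe_mul, inv_mul_cancel₀ (hΔ _)]
    simp
  have hfin : IsFiniteMeasureOnCompacts μ' := by
    refine ⟨fun C hC => ?_⟩
    rw [withDensity_apply _ hC.measurableSet]
    obtain ⟨B, hB⟩ := hC.bddAbove_image hc.continuousOn
    calc ∫⁻ x in C, δ x ∂μ.inv ≤ ∫⁻ x in C, (B : ℝ≥0∞) ∂μ.inv := by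
          refine setLIntegral_mono measurable_const fun x hx => ?_
          exact ENNReal.coe_le_coe.2 (hB ⟨x, hx, rfl⟩)
      _ = B * μ.inv C := by simp
      _ < ∞ := ENNReal.mul_lt_top (by simp) hC.measure_lt_top
  have hz : μ' (N ∩ K⁻¹) = 0 := by
    rw [Measure.measure_isMulInvariant_eq_smul_of_isCompact_closure μ' μ
      (hK.inv.closure_of_subset Set.inter_subset_right)]
    simp [measure_mono_null Set.inter_subset_left hN]
  have hz' : μ.inv (N ∩ K⁻¹) = 0 :=
    (withDensity_absolutelyContinuous' hδm.aemeasurable (by simp [δ, hΔ])) hz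
  rw [Measure.inv_apply] at hz'
  refine measure_mono_null (fun y hy => ?_) hz'
  simpa using ⟨hy.2, hy.1⟩

theorem sFinite_restrict_iUnion {K : ℕ → Set G} (hK : ∀ n, IsCompact (K n)) :
    SFinite (μ.restrict (⋃ n, K n)) := by
  have hm : ∀ n, MeasurableSet (disjointed K n) :=
    MeasurableSet.disjointed fun n => (hK n).measurableSet
  rw [← iUnion_disjointed, Measure.restrict_iUnion (disjoint_disjointed K) hm]
  have : ∀ n, IsFiniteMeasure (μ.restrict (disjointed K n)) := fun n =>
    ⟨by simpa using (measure_mono (disjointed_subset K n)).trans_lt (hK n).measure_lt_top⟩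
  infer_instance

/-- `f` is an almost everywhere limit of continuous compactly supported functions. -/
def IsAECompactLimit (f : G → ℂ) : Prop :=
  ∃ u : ℕ → G → ℂ, (∀ n, Continuous (u n)) ∧ (∀ n, HasCompactSupport (u n)) ∧
    ∀ᵐ x ∂μ, Tendsto (fun n => u n x) atTop (𝓝 (f x))

variable {μ}

theorem IsAECompactLimit.congr {f g : G → ℂ} (hf : IsAECompactLimit μ f) (h : f =ᵐ[μ] g) :
    IsAECompactLimit μ g := by
  obtain ⟨u, h1, h2, h3⟩ := hf
  exact ⟨u, h1, h2, by filter_upwards [h3, h] with x hx e; rwa [← e]⟩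

theorem exists_compactSupport_approx {f : G → ℂ} (hf : Integrable f μ) {ε : ℝ≥0∞} (hε : ε ≠ 0) :
    ∃ g : G → ℂ, eLpNorm (f - g) 1 μ ≤ ε ∧ Continuous g ∧ HasCompactSupport g := by
  refine (memLp_one_iff_integrable.2 hf).induction_dense ENNReal.one_ne_top
    (fun g => Continuous g ∧ HasCompactSupport g) ?_ ?_ ?_ hε
  rotate_left
  · rintro f g ⟨f1, f2⟩ ⟨g1, g2⟩
    exact ⟨f1.add g1, f2.add g2⟩
  · rintro f ⟨f1, f2⟩
    exact (f1.integrable_of_hasCompactSupport (μ := μ) f2).aestronglyMeasurable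
  intro c t ht htμ ε hε
  let η : ℝ≥0∞ := ε / (‖c‖ₑ * 2 + 1)
  have hη : η ≠ 0 := ENNReal.div_ne_zero.2 ⟨hε, by finiteness⟩
  obtain ⟨s, st, sc, -, μs⟩ := ht.exists_isCompact_isClosed_sdiff_lt htμ.ne hη
  obtain ⟨U, sU, hU, hμU⟩ := s.exists_isOpen_lt_add (μ := μ) sc.measure_lt_top.ne hη
  have hUs : μ (U \ s) < η :=
    measure_sdiff_lt_of_lt_add sc.nullMeasurableSet sU sc.measure_lt_top.ne hμU
  obtain ⟨φ, φs, φU, φc, φ1⟩ := exists_continuous_one_zero_of_isCompact sc hU.isClosed_compl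
    (Set.disjoint_compl_right_iff_subset.2 sU)
  refine ⟨fun x => (φ x : ℂ) * c, ?_, by fun_prop, HasCompactSupport.mul_right
    (φc.comp_left (g := fun r : ℝ => (r : ℂ)) Complex.ofReal_zero)⟩
  have hpt : ∀ x, ‖((fun x => (φ x : ℂ) * c) - t.indicator fun _ => c) x‖ₑ
      ≤ ((U \ s) ∪ (t \ s)).indicator (fun _ => ‖c‖ₑ) x := by
    intro x
    simp only [Pi.sub_apply]
    by_cases hx : x ∈ s
    · simp [φs hx, st hx]
    by_cases hxt : x ∈ t
    · have h1 : x ∈ (U \ s) ∪ (t \ s) := Or.inr ⟨hxt, hx⟩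
      rw [Set.indicator_of_mem hxt, Set.indicator_of_mem h1]
      rw [enorm_le_iff_norm_le]
      have : (φ x : ℂ) * c - c = ((φ x - 1 : ℝ) : ℂ) * c := by push_cast; ring
      rw [this, norm_mul, Complex.norm_real, Real.norm_eq_abs]
      have h2 := φ1 x
      exact mul_le_of_le_one_left (norm_nonneg _) (abs_le.2 ⟨by linarith [h2.1], by linarith [h2.2]⟩)
    by_cases hxU : x ∈ U
    · have h1 : x ∈ (U \ s) ∪ (t \ s) := Or.inl ⟨hxU, hx⟩
      rw [Set.indicator_of_notMem hxt, Set.indicator_of_mem h1, sub_zero, enorm_le_iff_norm_le,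
        norm_mul, Complex.norm_real, Real.norm_eq_abs]
      have h2 := φ1 x
      exact mul_le_of_le_one_left (norm_nonneg _) (abs_le.2 ⟨by linarith [h2.1], by linarith [h2.2]⟩)
    · simp [hxt, φU hxU]
  calc eLpNorm ((fun x => (φ x : ℂ) * c) - t.indicator fun _ => c) 1 μ
      ≤ ∫⁻ x, ((U \ s) ∪ (t \ s)).indicator (fun _ => ‖c‖ₑ) x ∂μ := by
        rw [eLpNorm_one_eq_lintegral_enorm]
        exact lintegral_mono hpt
    _ ≤ ‖c‖ₑ * μ ((U \ s) ∪ (t \ s)) := lintegral_indicator_const_le _ _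
    _ ≤ ‖c‖ₑ * (η + η) := by
        gcongr
        exact (measure_union_le _ _).trans (add_le_add hUs.le μs.le)
    _ = (‖c‖ₑ * 2) * η := by ring
    _ ≤ (‖c‖ₑ * 2 + 1) * η := by gcongr; exact le_self_add
    _ ≤ ε := ENNReal.mul_div_le

theorem isAECompactLimit_of_integrable {f : G → ℂ} (hf : Integrable f μ) :
    IsAECompactLimit μ f := by
  have h : ∀ n : ℕ, ∃ g : G → ℂ, eLpNorm (f - g) 1 μ ≤ ((n + 1 : ℕ) : ℝ≥0∞)⁻¹ ∧
      Continuous g ∧ HasCompactSupport g := fun n =>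
    exists_compactSupport_approx hf (ENNReal.inv_ne_zero.2 (ENNReal.natCast_ne_top _))
  choose g h2 h3 h1 using h
  have ht : Tendsto (fun n => eLpNorm (g n - f) 1 μ) atTop (𝓝 0) := by
    have : Tendsto (fun n : ℕ => ((n + 1 : ℕ) : ℝ≥0∞)⁻¹) atTop (𝓝 0) :=
      ENNReal.tendsto_inv_nat_nhds_zero.comp (tendsto_add_atTop_nat 1)
    refine tendsto_of_tendsto_of_tendsto_of_le_of_le tendsto_const_nhds this (fun _ => bot_le)
      fun n => ?_
    rw [← eLpNorm_neg, neg_sub]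
    exact h2 n
  obtain ⟨ns, -, hns⟩ := (tendstoInMeasure_of_tendsto_eLpNorm one_ne_zero
    (fun n => ((h3 n).integrable_of_hasCompactSupport (h1 n)).1) hf.1 ht).exists_seq_tendsto_ae
  exact ⟨fun n => g (ns n), fun n => h3 _, fun n => h1 _, hns⟩

theorem IsAECompactLimit.mul_continuous {f w : G → ℂ} (hf : IsAECompactLimit μ f)
    (hw : Continuous w) : IsAECompactLimit μ (fun x => f x * w x) := by
  obtain ⟨u, h1, h2, h3⟩ := hf
  refine ⟨fun n x => u n x * w x, fun n => (h1 n).mul hw, fun n => (h2 n).mul_right, ?_⟩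
  filter_upwards [h3] with x hx
  exact hx.mul_const _

open scoped Pointwise in
theorem exists_kernel {f g : G → ℂ} (hf : IsAECompactLimit μ f) (hg : IsAECompactLimit μ g) :
    ∃ (L : G × G → ℂ) (S T : Set G), StronglyMeasurable L ∧ MeasurableSet S ∧ MeasurableSet T ∧
      SFinite (μ.restrict S) ∧ SFinite (μ.restrict T) ∧
      (∀ x y, x ∉ S ∨ y ∉ T → L (x, y) = 0) ∧
      (∀ x, ∀ f' g' : G → ℂ, f =ᵐ[μ] f' → g =ᵐ[μ] g' →
        (fun y => f' y * g' (y⁻¹ * x)) =ᵐ[μ] fun y => L (x, y)) ∧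
      (∀ᵐ y ∂μ, ∀ᵐ x ∂μ, L (x, y) = f y * g (y⁻¹ * x)) := by
  obtain ⟨u, u1, u2, u3⟩ := hf
  obtain ⟨v, v1, v2, v3⟩ := hg
  let W : ℕ → G × G → ℂ := fun n p => u n p.2 * v n (p.2⁻¹ * p.1)
  let S : Set G := ⋃ n, tsupport (u n) * tsupport (v n)
  let T : Set G := ⋃ n, tsupport (u n)
  have hWs : ∀ n x y, W n (x, y) ≠ 0 →
      x ∈ tsupport (u n) * tsupport (v n) ∧ y ∈ tsupport (u n) := by
    intro n x y h
    have hy := subset_tsupport _ (left_ne_zero_of_mul h : u n y ≠ 0)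
    have hx := subset_tsupport _ (right_ne_zero_of_mul h : v n (y⁻¹ * x) ≠ 0)
    exact ⟨⟨y, hy, y⁻¹ * x, hx, by simp⟩, hy⟩
  have hWc : ∀ n, Continuous (W n) := fun n =>
    ((u1 n).comp continuous_snd).mul ((v1 n).comp (by fun_prop))
  have hWk : ∀ n, HasCompactSupport (W n) := by
    intro n
    refine HasCompactSupport.intro (((u2 n).isCompact.mul (v2 n).isCompact).prod (u2 n).isCompact)
      fun p hp => ?_
    by_contra h
    exact hp (hWs n p.1 p.2 h)
  have hW0 : ∀ n x y, x ∉ S ∨ y ∉ T → W n (x, y) = 0 := by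
    intro n x y h
    by_contra h'
    obtain ⟨a, b⟩ := hWs n x y h'
    rcases h with h | h
    · exact h (Set.mem_iUnion.2 ⟨n, a⟩)
    · exact h (Set.mem_iUnion.2 ⟨n, b⟩)
  refine ⟨fun p => limUnder atTop (fun n => W n p), S, T,
    StronglyMeasurable.limUnder fun n => (hWk n).stronglyMeasurable_of_prod (hWc n),
    MeasurableSet.iUnion fun n => ((u2 n).isCompact.mul (v2 n).isCompact).measurableSet,
    MeasurableSet.iUnion fun n => (u2 n).isCompact.measurableSet,
    sFinite_restrict_iUnion μ fun n => (u2 n).isCompact.mul (v2 n).isCompact,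
    sFinite_restrict_iUnion μ fun n => (u2 n).isCompact, ?_, ?_, ?_⟩
  · intro x y h
    have : (fun n => W n (x, y)) = fun _ => 0 := funext fun n => hW0 n x y h
    simp only [this]
    exact tendsto_const_nhds.limUnder_eq
  · intro x f' g' hf' hg'
    have hN : μ {z | ¬ Tendsto (fun n => v n z) atTop (𝓝 (g' z))} = 0 := by
      have : ∀ᵐ z ∂μ, Tendsto (fun n => v n z) atTop (𝓝 (g' z)) := by
        filter_upwards [v3, hg'] with z hz e
        rwa [← e]
      exact this
    have hT : ∀ᵐ y ∂μ, y ∈ T → Tendsto (fun n => v n (y⁻¹ * x)) atTop (𝓝 (g' (y⁻¹ * x))) := by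
      simp only [T, Set.mem_iUnion, forall_exists_index]
      refine ae_all_iff.2 fun m => ?_
      have h1 := null_inv_of_isCompact μ hN
        ((u2 m).isCompact.image (continuous_const_mul x⁻¹))
      have h2 := (measurePreserving_mul_left μ x⁻¹).quasiMeasurePreserving.preimage_null h1
      refine measure_mono_null (fun y hy => ?_) h2
      simp only [Set.mem_compl_iff, Set.mem_ofPred_eq, Classical.not_imp] at hy
      refine ⟨⟨y, hy.1, rfl⟩, ?_⟩
      simpa using hy.2
    filter_upwards [u3, hf', hT] with y hy e hy'
    by_cases hyT : y ∈ T
    · exact ((hy.mul (hy' hyT)).limUnder_eq.trans (by rw [e])).symm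
    · have h0 : ∀ n, u n y = 0 := fun n => by
        by_contra h
        exact hyT (Set.mem_iUnion.2 ⟨n, subset_tsupport _ h⟩)
      have hfy : f y = 0 := by
        simp only [h0] at hy
        exact tendsto_nhds_unique hy tendsto_const_nhds
      have : (fun n => W n (x, y)) = fun _ => 0 := funext fun n => hW0 n x y (Or.inr hyT)
      simp only [this, ← e, hfy, zero_mul]
      exact tendsto_const_nhds.limUnder_eq.symm
  · filter_upwards [u3] with y hy
    have := (measurePreserving_mul_left μ y⁻¹).quasiMeasurePreserving.ae v3
    filter_upwards [this] with x hx
    exact (hy.mul hx).limUnder_eq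


section Weighted
variable {w : G → ℝ}

variable (μ w) in
/-- The measure `w(x) dx`. -/
noncomputable def wMeasure : Measure G := μ.withDensity fun x => ENNReal.ofReal (w x)

theorem lintegral_wMeasure (hw : Continuous w) (F : G → ℝ≥0∞) :
    ∫⁻ x, F x ∂wMeasure μ w = ∫⁻ x, ENNReal.ofReal (w x) * F x ∂μ :=
  lintegral_withDensity_eq_lintegral_mul_non_measurable _ hw.measurable.ennreal_ofReal
    (by simp) F

theorem ae_wMeasure (hw : Continuous w) (hpos : ∀ x, 0 < w x) : ae (wMeasure μ w) = ae μ :=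
  le_antisymm (withDensity_absolutelyContinuous _ _).ae_le
    (withDensity_absolutelyContinuous' hw.measurable.ennreal_ofReal.aemeasurable
      (by simp [hpos])).ae_le

theorem aestronglyMeasurable_wMeasure (hw : Continuous w) (hpos : ∀ x, 0 < w x) {f : G → ℂ} :
    AEStronglyMeasurable f (wMeasure μ w) ↔ AEStronglyMeasurable f μ := by
  unfold AEStronglyMeasurable Filter.EventuallyEq
  simp only [ae_wMeasure hw hpos]

theorem isAECompactLimit_of_integrable_wMeasure (hw : Continuous w)
    (hpos : ∀ x, 0 < w x) {f : G → ℂ} (hf : Integrable f (wMeasure μ w)) :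
    IsAECompactLimit μ f := by
  have h1 : Integrable (fun x => f x * (w x : ℂ)) μ := by
    refine ⟨((aestronglyMeasurable_wMeasure hw hpos).1 hf.1).mul
      (by fun_prop : Continuous fun x => (w x : ℂ)).aestronglyMeasurable, ?_⟩
    have h2 := hf.2
    unfold HasFiniteIntegral at h2 ⊢
    rw [lintegral_wMeasure hw] at h2
    convert h2 using 3 with x
    rw [enorm_mul, mul_comm, ← ofReal_norm (w x : ℂ), Complex.norm_real,
      Real.norm_of_nonneg (hpos x).le]
  have h3 := (isAECompactLimit_of_integrable h1).mul_continuous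
    (w := fun x => ((w x)⁻¹ : ℂ)) (by
      have := hw.inv₀ (fun x => (hpos x).ne')
      have h4 : Continuous fun x => (((w x)⁻¹ : ℝ) : ℂ) := Complex.continuous_ofReal.comp this
      simpa using h4)
  refine h3.congr (Eventually.of_forall fun x => ?_)
  have : (w x : ℂ) ≠ 0 := by exact_mod_cast (hpos x).ne'
  simp [this]

theorem lintegral_convolution_le (hw : Continuous w) (hpos : ∀ x, 0 < w x) (hmul : ∀ x y, w
    (x * y) ≤ w x * w y) {f g : G → ℂ} (hf : Integrable f (wMeasure μ w))
    (hg : Integrable g (wMeasure μ w)) :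
    ∫⁻ x, ∫⁻ y, ‖f y * g (y⁻¹ * x)‖ₑ ∂μ ∂wMeasure μ w
      ≤ (∫⁻ x, ‖f x‖ₑ ∂wMeasure μ w) * ∫⁻ x, ‖g x‖ₑ ∂wMeasure μ w := by
  have hgfin : ∫⁻ x, ‖g x‖ₑ ∂wMeasure μ w ≠ ∞ := hg.2.ne
  obtain ⟨L, S, T, hL, hS, hT, iS, iT, h0, h1, h2⟩ := exists_kernel
    (isAECompactLimit_of_integrable_wMeasure hw hpos hf)
    (isAECompactLimit_of_integrable_wMeasure hw hpos hg)
  let H : G → G → ℝ≥0∞ := fun x y => ENNReal.ofReal (w x) * ‖L (x, y)‖ₑ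
  have hH : Measurable (Function.uncurry H) :=
    ((hw.measurable.comp measurable_fst).ennreal_ofReal).mul hL.enorm
  have hr : ∀ x, ∫⁻ y, H x y ∂μ = ∫⁻ y in T, H x y ∂μ := fun x =>
    (setLIntegral_eq_of_support_subset fun y hy => by
      by_contra h
      exact hy (by simp [H, h0 x y (Or.inr h)])).symm
  have hr' : ∀ y, ∫⁻ x, H x y ∂μ = ∫⁻ x in S, H x y ∂μ := fun y =>
    (setLIntegral_eq_of_support_subset fun x hx => by
      by_contra h
      exact hx (by simp [H, h0 x y (Or.inl h)])).symm
  have hswap : ∫⁻ x, ∫⁻ y, H x y ∂μ ∂μ = ∫⁻ y, ∫⁻ x, H x y ∂μ ∂μ := by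
    calc ∫⁻ x, ∫⁻ y, H x y ∂μ ∂μ = ∫⁻ x in S, ∫⁻ y, H x y ∂μ ∂μ :=
          (setLIntegral_eq_of_support_subset fun x hx => by
            by_contra h
            exact hx (by simp [H, h0 x _ (Or.inl h)])).symm
      _ = ∫⁻ x in S, ∫⁻ y in T, H x y ∂μ ∂μ := by simp_rw [hr]
      _ = ∫⁻ y in T, ∫⁻ x in S, H x y ∂μ ∂μ := lintegral_lintegral_swap hH.aemeasurable
      _ = ∫⁻ y in T, ∫⁻ x, H x y ∂μ ∂μ := by simp_rw [hr']
      _ = ∫⁻ y, ∫⁻ x, H x y ∂μ ∂μ :=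
          (setLIntegral_eq_of_support_subset fun y hy => by
            by_contra h
            exact hy (by simp [H, h0 _ y (Or.inr h)]))
  calc ∫⁻ x, ∫⁻ y, ‖f y * g (y⁻¹ * x)‖ₑ ∂μ ∂wMeasure μ w
      = ∫⁻ x, ∫⁻ y, H x y ∂μ ∂μ := by
        rw [lintegral_wMeasure hw]
        refine lintegral_congr fun x => ?_
        rw [← lintegral_const_mul' _ _ (by simp)]
        refine lintegral_congr_ae ?_
        filter_upwards [h1 x f g (ae_eq_refl f) (ae_eq_refl g)] with y hy
        simp only [H, ← hy]
    _ = ∫⁻ y, ∫⁻ x, H x y ∂μ ∂μ := hswap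
    _ ≤ ∫⁻ y, (ENNReal.ofReal (w y) * ‖f y‖ₑ) * ∫⁻ x, ‖g x‖ₑ ∂wMeasure μ w ∂μ := by
        refine lintegral_mono_ae ?_
        filter_upwards [h2] with y hy
        rw [lintegral_wMeasure hw,
          ← lintegral_mul_left_eq_self (fun x => ENNReal.ofReal (w x) * ‖g x‖ₑ) y⁻¹,
          ← lintegral_const_mul' _ _ (by finiteness)]
        refine lintegral_mono_ae ?_
        filter_upwards [hy] with x hx
        simp only [H, hx, enorm_mul]
        calc ENNReal.ofReal (w x) * (‖f y‖ₑ * ‖g (y⁻¹ * x)‖ₑ)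
            ≤ (ENNReal.ofReal (w y) * ENNReal.ofReal (w (y⁻¹ * x))) *
              (‖f y‖ₑ * ‖g (y⁻¹ * x)‖ₑ) := by
              gcongr
              rw [← ENNReal.ofReal_mul (hpos y).le]
              exact ENNReal.ofReal_le_ofReal (by simpa using hmul y (y⁻¹ * x))
          _ = _ := by ring
    _ = _ := by rw [lintegral_mul_const' _ _ hgfin, ← lintegral_wMeasure hw]

variable (μ) in
/-- The convolution `(f * g)(x) = ∫ f(y) g(y⁻¹x) dy`. -/
noncomputable def convolution (f g : G → ℂ) (x : G) : ℂ := ∫ y, f y * g (y⁻¹ * x) ∂μ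

theorem stronglyMeasurable_convolution (hw : Continuous w) (hpos : ∀ x, 0 < w x) {f g : G → ℂ}
    (hf : Integrable f (wMeasure μ w))
    (hg : Integrable g (wMeasure μ w)) : StronglyMeasurable (convolution μ f g) := by
  obtain ⟨L, S, T, hL, hS, hT, iS, iT, h0, h1, h2⟩ := exists_kernel
    (isAECompactLimit_of_integrable_wMeasure hw hpos hf)
    (isAECompactLimit_of_integrable_wMeasure hw hpos hg)
  have : convolution μ f g = fun x => ∫ y in T, L (x, y) ∂μ := by
    funext x
    rw [setIntegral_eq_integral_of_forall_compl_eq_zero fun y hy => h0 x y (Or.inr hy)]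
    exact integral_congr_ae (h1 x f g (ae_eq_refl f) (ae_eq_refl g))
  rw [this]
  exact hL.integral_prod_right'

theorem convolution_congr (hw : Continuous w) (hpos : ∀ x, 0 < w x) {f g f' g' : G → ℂ}
    (hf : Integrable f (wMeasure μ w))
    (hg : Integrable g (wMeasure μ w)) (hf' : f =ᵐ[μ] f') (hg' : g =ᵐ[μ] g') :
    convolution μ f g = convolution μ f' g' := by
  obtain ⟨L, S, T, hL, hS, hT, iS, iT, h0, h1, h2⟩ := exists_kernel
    (isAECompactLimit_of_integrable_wMeasure hw hpos hf)
    (isAECompactLimit_of_integrable_wMeasure hw hpos hg)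
  funext x
  exact (integral_congr_ae (h1 x f g (ae_eq_refl f) (ae_eq_refl g))).trans
    (integral_congr_ae (h1 x f' g' hf' hg')).symm

theorem lintegral_enorm_convolution_le (hw : Continuous w) (hpos : ∀ x, 0 < w x) (hmul : ∀ x y, w
    (x * y) ≤ w x * w y) {f g : G → ℂ} (hf : Integrable f (wMeasure μ w))
    (hg : Integrable g (wMeasure μ w)) :
    ∫⁻ x, ‖convolution μ f g x‖ₑ ∂wMeasure μ w
      ≤ (∫⁻ x, ‖f x‖ₑ ∂wMeasure μ w) * ∫⁻ x, ‖g x‖ₑ ∂wMeasure μ w :=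
  (lintegral_mono fun _ => enorm_integral_le_lintegral_enorm _).trans
    (lintegral_convolution_le hw hpos hmul hf hg)

theorem integrable_convolution (hw : Continuous w) (hpos : ∀ x, 0 < w x) (hmul : ∀ x y, w
    (x * y) ≤ w x * w y) {f g : G → ℂ} (hf : Integrable f (wMeasure μ w))
    (hg : Integrable g (wMeasure μ w)) : Integrable (convolution μ f g) (wMeasure μ w) :=
  ⟨(stronglyMeasurable_convolution hw hpos hf hg).aestronglyMeasurable,
    (lintegral_enorm_convolution_le hw hpos hmul hf hg).trans_lt (ENNReal.mul_lt_top hf.2 hg.2)⟩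

theorem ae_integrable_convolution (hw : Continuous w) (hpos : ∀ x, 0 < w x) (hmul : ∀ x y, w
    (x * y) ≤ w x * w y) {f g : G → ℂ} (hf : Integrable f (wMeasure μ w))
    (hg : Integrable g (wMeasure μ w)) :
    ∀ᵐ x ∂μ, Integrable (fun y => f y * g (y⁻¹ * x)) μ := by
  obtain ⟨L, S, T, hL, hS, hT, iS, iT, h0, h1, h2⟩ := exists_kernel
    (isAECompactLimit_of_integrable_wMeasure hw hpos hf)
    (isAECompactLimit_of_integrable_wMeasure hw hpos hg)
  let F : G → ℝ≥0∞ := fun x => ∫⁻ y in T, ‖L (x, y)‖ₑ ∂μ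
  have hF : Measurable F := hL.enorm.lintegral_prod_right'
  have hFe : ∀ x, ∫⁻ y, ‖f y * g (y⁻¹ * x)‖ₑ ∂μ = F x := by
    intro x
    simp only [F]
    rw [setLIntegral_eq_of_support_subset fun y hy => by
      by_contra h
      exact hy (by simp [h0 x y (Or.inr h)])]
    refine lintegral_congr_ae ?_
    filter_upwards [h1 x f g (ae_eq_refl f) (ae_eq_refl g)] with y hy
    rw [hy]
  have hlt : ∫⁻ x, F x ∂wMeasure μ w ≠ ∞ := by
    simp_rw [← hFe]
    exact ((lintegral_convolution_le hw hpos hmul hf hg).trans_lt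
      (ENNReal.mul_lt_top hf.2 hg.2)).ne
  have hae := ae_lt_top hF hlt
  rw [ae_wMeasure hw hpos] at hae
  filter_upwards [hae] with x hx
  refine ⟨?_, by rw [← hFe] at hx; exact hx⟩
  exact (hL.comp_measurable measurable_prodMk_left).aestronglyMeasurable.congr
    (h1 x f g (ae_eq_refl f) (ae_eq_refl g)).symm

end Weighted

open scoped Pointwise in
theorem convolution_assoc_of_hasCompactSupport {f g h : G → ℂ} (hf : Continuous f)
    (hg : Continuous g) (hh : Continuous h) (hf' : HasCompactSupport f)
    (hg' : HasCompactSupport g) :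
    convolution μ (convolution μ f g) h = convolution μ f (convolution μ g h) := by
  funext x
  simp only [convolution]
  have h1 : ∀ y, ∫ z, g z * h (z⁻¹ * (y⁻¹ * x)) ∂μ = ∫ z, g (y⁻¹ * z) * h (z⁻¹ * x) ∂μ := by
    intro y
    rw [← integral_mul_left_eq_self _ y⁻¹]
    simp [mul_assoc]
  simp_rw [h1, ← integral_const_mul, ← integral_mul_const]
  rw [integral_integral_swap_of_hasCompactSupport]
  · simp_rw [mul_assoc]
  · simp only [Function.uncurry_def]
    fun_prop
  · refine HasCompactSupport.intro
      ((hf'.isCompact.mul hg'.isCompact).prod hf'.isCompact) fun p hp => ?_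
    by_contra hne
    have ha : f p.2 * g (p.2⁻¹ * p.1) ≠ 0 := left_ne_zero_of_mul hne
    have hy := subset_tsupport _ (left_ne_zero_of_mul ha)
    have hz := subset_tsupport _ (right_ne_zero_of_mul ha)
    exact hp ⟨⟨p.2, hy, p.2⁻¹ * p.1, hz, by simp⟩, hy⟩


variable (μ) in
/-- The space `L¹(G, ω)` formed with respect to the left Haar measure `μ`: classes of functions
that are integrable against `ω dμ`, with norm `∫ |f| ω dμ`. -/
def WeightedL1 (ω : Weight G) : Type _ := Lp ℂ 1 (wMeasure μ ω)

namespace WeightedL1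
variable {ω : Weight G}

noncomputable instance : NormedAddCommGroup (WeightedL1 μ ω) :=
  inferInstanceAs (NormedAddCommGroup (Lp ℂ 1 (wMeasure μ ω)))

noncomputable instance : NormedSpace ℂ (WeightedL1 μ ω) :=
  inferInstanceAs (NormedSpace ℂ (Lp ℂ 1 (wMeasure μ ω)))

instance : CompleteSpace (WeightedL1 μ ω) :=
  inferInstanceAs (CompleteSpace (Lp ℂ 1 (wMeasure μ ω)))

/-- A representative of an element of `L¹(G, ω)`. -/
noncomputable def rep (f : WeightedL1 μ ω) : G → ℂ := ((show Lp ℂ 1 (wMeasure μ ω) from f) : G → ℂ)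

theorem integrable_rep (f : WeightedL1 μ ω) : Integrable (rep f) (wMeasure μ ω) :=
  L1.integrable_coeFn (show Lp ℂ 1 (wMeasure μ ω) from f)

/-- The class of a function that is integrable against `ω dμ`. -/
noncomputable def mk (f : G → ℂ) (hf : Integrable f (wMeasure μ ω)) : WeightedL1 μ ω := hf.toL1 f

/-- The product of `L¹(G, ω)` is convolution. -/
noncomputable instance : Mul (WeightedL1 μ ω) where
  mul f g := mk (convolution μ (rep f) (rep g)) (integrable_convolution ω.continuous_toFun ω.pos
    ω.mul_le (integrable_rep f) (integrable_rep g))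

theorem rep_mk (f : G → ℂ) (hf : Integrable f (wMeasure μ ω)) : rep (mk f hf) =ᵐ[μ] f := by
  have h := hf.coeFn_toL1
  unfold Filter.EventuallyEq at h ⊢
  rwa [ae_wMeasure ω.continuous_toFun ω.pos] at h

theorem rep_mul (f g : WeightedL1 μ ω) : rep (f * g) =ᵐ[μ] convolution μ (rep f) (rep g) :=
  rep_mk _ _

theorem rep_add (f g : WeightedL1 μ ω) : rep (f + g) =ᵐ[μ] fun x => rep f x + rep g x := by
  have h := Lp.coeFn_add (show Lp ℂ 1 (wMeasure μ ω) from f) (show Lp ℂ 1 (wMeasure μ ω) from g)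
  unfold Filter.EventuallyEq at h ⊢
  rwa [ae_wMeasure ω.continuous_toFun ω.pos] at h

theorem rep_smul (c : ℂ) (f : WeightedL1 μ ω) : rep (c • f) =ᵐ[μ] fun x => c * rep f x := by
  have h := Lp.coeFn_smul c (show Lp ℂ 1 (wMeasure μ ω) from f)
  unfold Filter.EventuallyEq at h ⊢
  rwa [ae_wMeasure ω.continuous_toFun ω.pos] at h

theorem ext {f g : WeightedL1 μ ω} (h : rep f =ᵐ[μ] rep g) : f = g := by
  refine Lp.ext (μ := wMeasure μ ω) ?_
  unfold Filter.EventuallyEq at h ⊢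
  rwa [ae_wMeasure ω.continuous_toFun ω.pos]

theorem norm_eq_lintegral (f : WeightedL1 μ ω) :
    ‖f‖ = (∫⁻ x, ‖rep f x‖ₑ ∂wMeasure μ ω).toReal :=
  L1.norm_def (show Lp ℂ 1 (wMeasure μ ω) from f)

theorem norm_eq_integral (f : WeightedL1 μ ω) : ‖f‖ = ∫ x, ‖rep f x‖ * ω x ∂μ := by
  rw [norm_eq_lintegral, lintegral_wMeasure ω.continuous_toFun, integral_eq_lintegral_of_nonneg_ae]
  · congr 1
    refine lintegral_congr fun x => ?_
    rw [ENNReal.ofReal_mul (norm_nonneg _), ofReal_norm, mul_comm]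
  · exact Eventually.of_forall fun x => mul_nonneg (norm_nonneg _) (ω.pos x).le
  · exact ((aestronglyMeasurable_wMeasure ω.continuous_toFun ω.pos).1
      (integrable_rep f).1).norm.mul ω.continuous_toFun.aestronglyMeasurable

theorem norm_mul_le' (f g : WeightedL1 μ ω) : ‖f * g‖ ≤ ‖f‖ * ‖g‖ := by
  rw [norm_eq_lintegral, norm_eq_lintegral, norm_eq_lintegral, ← ENNReal.toReal_mul]
  refine ENNReal.toReal_mono (ENNReal.mul_ne_top (integrable_rep f).2.ne (integrable_rep g).2.ne) ?_
  refine le_trans (le_of_eq ?_) (lintegral_enorm_convolution_le ω.continuous_toFun ω.pos ω.mul_le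
    (integrable_rep f) (integrable_rep g))
  refine lintegral_congr_ae ?_
  rw [Filter.EventuallyEq, ae_wMeasure ω.continuous_toFun ω.pos]
  filter_upwards [rep_mul f g] with x hx
  rw [hx]

theorem mul_add' (a b c : WeightedL1 μ ω) : a * (b + c) = a * b + a * c := by
  refine ext ?_
  have hi := ae_integrable_convolution ω.continuous_toFun ω.pos ω.mul_le (integrable_rep a)
    (integrable_rep b)
  have hi' := ae_integrable_convolution ω.continuous_toFun ω.pos ω.mul_le (integrable_rep a)
    (integrable_rep c)
  have hc := convolution_congr ω.continuous_toFun ω.pos (integrable_rep a)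
    (integrable_rep (b + c)) (ae_eq_refl _) (rep_add b c)
  filter_upwards [rep_mul a (b + c), rep_add (a * b) (a * c), rep_mul a b, rep_mul a c, hi, hi']
    with x h1 h2 h3 h4 h5 h6
  rw [h1, h2, h3, h4, hc]
  simp only [convolution, mul_add]
  exact integral_add h5 h6

theorem add_mul' (a b c : WeightedL1 μ ω) : (a + b) * c = a * c + b * c := by
  refine ext ?_
  have hi := ae_integrable_convolution ω.continuous_toFun ω.pos ω.mul_le (integrable_rep a)
    (integrable_rep c)
  have hi' := ae_integrable_convolution ω.continuous_toFun ω.pos ω.mul_le (integrable_rep b)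
    (integrable_rep c)
  have hc := convolution_congr ω.continuous_toFun ω.pos (integrable_rep (a + b))
    (integrable_rep c) (rep_add a b) (ae_eq_refl _)
  filter_upwards [rep_mul (a + b) c, rep_add (a * c) (b * c), rep_mul a c, rep_mul b c, hi, hi']
    with x h1 h2 h3 h4 h5 h6
  rw [h1, h2, h3, h4, hc]
  simp only [convolution, add_mul]
  exact integral_add h5 h6

theorem smul_mul' (r : ℂ) (a b : WeightedL1 μ ω) : (r • a) * b = r • (a * b) := by
  refine ext ?_
  have hc := convolution_congr ω.continuous_toFun ω.pos (integrable_rep (r • a))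
    (integrable_rep b) (rep_smul r a) (ae_eq_refl _)
  filter_upwards [rep_mul (r • a) b, rep_smul r (a * b), rep_mul a b] with x h1 h2 h3
  rw [h1, h2, h3, hc]
  simp only [convolution, mul_assoc]
  exact integral_const_mul _ _

theorem mul_smul' (r : ℂ) (a b : WeightedL1 μ ω) : a * (r • b) = r • (a * b) := by
  refine ext ?_
  have hc := convolution_congr ω.continuous_toFun ω.pos (integrable_rep a)
    (integrable_rep (r • b)) (ae_eq_refl _) (rep_smul r b)
  filter_upwards [rep_mul a (r • b), rep_smul r (a * b), rep_mul a b] with x h1 h2 h3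
  rw [h1, h2, h3, hc]
  simp only [convolution, mul_left_comm _ r]
  exact integral_const_mul _ _

variable (μ ω) in
/-- The classes of continuous compactly supported functions. -/
def compactlySupported : Set (WeightedL1 μ ω) :=
  {a | ∃ f : G → ℂ, Continuous f ∧ HasCompactSupport f ∧ rep a =ᵐ[μ] f}

theorem dense_compactlySupported : Dense (compactlySupported μ ω) := by
  intro a
  rw [Metric.mem_closure_iff]
  intro ε hε
  have hw0 : ∀ x, ((ω x : ℝ) : ℂ) ≠ 0 := fun x => by exact_mod_cast (ω.pos x).ne'
  have hwc : Continuous fun x => ((ω x : ℝ) : ℂ) :=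
    Complex.continuous_ofReal.comp ω.continuous_toFun
  have hen : ∀ x, ‖((ω x : ℝ) : ℂ)‖ₑ = ENNReal.ofReal (ω x) := fun x => by
    rw [← ofReal_norm, Complex.norm_real, Real.norm_of_nonneg (ω.pos x).le]
  have h1 : Integrable (fun x => rep a x * (ω x : ℂ)) μ := by
    refine ⟨((aestronglyMeasurable_wMeasure ω.continuous_toFun ω.pos).1
      (integrable_rep a).1).mul hwc.aestronglyMeasurable, ?_⟩
    have h2 := (integrable_rep a).2
    unfold HasFiniteIntegral at h2 ⊢
    rw [lintegral_wMeasure ω.continuous_toFun] at h2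
    convert h2 using 3 with x
    rw [enorm_mul, mul_comm, hen]
  obtain ⟨g, hg, gc, gs⟩ := exists_compactSupport_approx h1
    (ε := ENNReal.ofReal (ε / 2)) (by simpa using hε)
  have hc : Continuous fun x => g x * ((ω x : ℝ) : ℂ)⁻¹ := gc.mul (hwc.inv₀ hw0)
  have hs : HasCompactSupport fun x => g x * ((ω x : ℝ) : ℂ)⁻¹ := gs.mul_right
  have hi : Integrable (fun x => g x * ((ω x : ℝ) : ℂ)⁻¹) (wMeasure μ ω) := by
    refine ⟨hc.aestronglyMeasurable, ?_⟩
    have h2 := (gc.integrable_of_hasCompactSupport (μ := μ) gs).2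
    unfold HasFiniteIntegral at h2 ⊢
    rw [lintegral_wMeasure ω.continuous_toFun]
    convert h2 using 3 with x
    rw [← hen, mul_comm, ← enorm_mul, mul_assoc, inv_mul_cancel₀ (hw0 x), mul_one]
  refine ⟨mk _ hi, ⟨_, hc, hs, rep_mk _ hi⟩, ?_⟩
  have hd : dist a (mk _ hi) = (∫⁻ x, edist (rep a x) (rep (mk _ hi) x) ∂wMeasure μ ω).toReal :=
    L1.dist_def (show Lp ℂ 1 (wMeasure μ ω) from a) (show Lp ℂ 1 (wMeasure μ ω) from mk _ hi)
  rw [hd]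
  have hle : ∫⁻ x, edist (rep a x) (rep (mk _ hi) x) ∂wMeasure μ ω ≤ ENNReal.ofReal (ε / 2) := by
    refine le_trans (le_of_eq ?_) hg
    rw [lintegral_wMeasure ω.continuous_toFun, eLpNorm_one_eq_lintegral_enorm]
    refine lintegral_congr_ae ?_
    filter_upwards [rep_mk _ hi] with x hx
    rw [hx, edist_eq_enorm_sub, ← hen, mul_comm, ← enorm_mul, sub_mul, mul_assoc,
      inv_mul_cancel₀ (hw0 x), mul_one, Pi.sub_apply]
  calc _ ≤ (ENNReal.ofReal (ε / 2)).toReal := ENNReal.toReal_mono (by simp) hle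
    _ = ε / 2 := ENNReal.toReal_ofReal (by positivity)
    _ < ε := by linarith

/-- Convolution as a bounded bilinear map. -/
noncomputable def mulL : WeightedL1 μ ω →L[ℂ] WeightedL1 μ ω →L[ℂ] WeightedL1 μ ω :=
  LinearMap.mkContinuous₂ (LinearMap.mk₂ ℂ (fun a b : WeightedL1 μ ω => a * b) add_mul' smul_mul'
    mul_add' mul_smul') 1 fun a b => by simpa using norm_mul_le' a b

theorem continuous_mul_right' (b : WeightedL1 μ ω) : Continuous fun a : WeightedL1 μ ω => a * b :=
  (mulL.flip b).continuous

theorem continuous_mul_left' (a : WeightedL1 μ ω) : Continuous fun b : WeightedL1 μ ω => a * b :=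
  (mulL a).continuous

theorem mul_assoc' (a b c : WeightedL1 μ ω) : a * b * c = a * (b * c) := by
  have hD := dense_compactlySupported (μ := μ) (ω := ω)
  have h3 : ∀ a ∈ compactlySupported μ ω, ∀ b ∈ compactlySupported μ ω,
      ∀ c ∈ compactlySupported μ ω, a * b * c = a * (b * c) := by
    rintro a ⟨f, fc, fs, hf⟩ b ⟨g, gc, gs, hg⟩ c ⟨h, hc, hs, hh⟩
    refine ext ?_
    have e1 := convolution_congr ω.continuous_toFun ω.pos (integrable_rep (a * b))
      (integrable_rep c) (rep_mul a b) hh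
    have e2 := convolution_congr ω.continuous_toFun ω.pos (integrable_rep a)
      (integrable_rep (b * c)) hf (rep_mul b c)
    have e3 := convolution_congr ω.continuous_toFun ω.pos (integrable_rep a) (integrable_rep b)
      hf hg
    have e4 := convolution_congr ω.continuous_toFun ω.pos (integrable_rep b) (integrable_rep c)
      hg hh
    filter_upwards [rep_mul (a * b) c, rep_mul a (b * c)] with x h1 h2
    rw [h1, h2, e1, e2, e3, e4, convolution_assoc_of_hasCompactSupport fc gc hc fs gs]
  have h2 : ∀ a ∈ compactlySupported μ ω, ∀ b ∈ compactlySupported μ ω,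
      ∀ c, a * b * c = a * (b * c) := fun a ha b hb c =>
    (isClosed_eq (continuous_mul_left' (a * b))
      ((continuous_mul_left' a).comp (continuous_mul_left' b))).closure_subset_iff.2
      (fun c hc => h3 a ha b hb c hc) (hD c)
  have h1 : ∀ a ∈ compactlySupported μ ω, ∀ b c, a * b * c = a * (b * c) := fun a ha b c =>
    (isClosed_eq ((continuous_mul_right' c).comp (continuous_mul_left' a))
      ((continuous_mul_left' a).comp (continuous_mul_right' c))).closure_subset_iff.2
      (fun b hb => h2 a ha b hb c) (hD b)
  exact (isClosed_eq ((continuous_mul_right' c).comp (continuous_mul_right' b))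
      (continuous_mul_right' (b * c))).closure_subset_iff.2
      (fun a ha => h1 a ha b c) (hD a)

noncomputable instance : NonUnitalNormedRing (WeightedL1 μ ω) :=
  { (inferInstance : NormedAddCommGroup (WeightedL1 μ ω)),
    (inferInstance : Mul (WeightedL1 μ ω)) with
    left_distrib := mul_add'
    right_distrib := add_mul'
    zero_mul := fun a => by simpa using smul_mul' 0 0 a
    mul_zero := fun a => by simpa using mul_smul' 0 a 0
    mul_assoc := mul_assoc'
    norm_mul_le := norm_mul_le' }

instance : IsScalarTower ℂ (WeightedL1 μ ω) (WeightedL1 μ ω) := ⟨smul_mul'⟩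

instance : SMulCommClass ℂ (WeightedL1 μ ω) (WeightedL1 μ ω) := ⟨fun r a b => (mul_smul' r a b).symm⟩

end WeightedL1
end Generic

section WeakAmenability
variable {A : Type*} [NonUnitalNormedRing A] [NormedSpace ℂ A] [IsScalarTower ℂ A A]
  [SMulCommClass ℂ A A]

/-- The left module action of `A` on its dual: `⟨x, a · φ⟩ = ⟨x a, φ⟩`. -/
noncomputable def dualLeft (a : A) (φ : StrongDual ℂ A) : StrongDual ℂ A :=
  φ.comp ((ContinuousLinearMap.mul ℂ A).flip a)

/-- The right module action of `A` on its dual: `⟨x, φ · a⟩ = ⟨a x, φ⟩`. -/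
noncomputable def dualRight (φ : StrongDual ℂ A) (a : A) : StrongDual ℂ A :=
  φ.comp (ContinuousLinearMap.mul ℂ A a)

variable (A) in
/-- A Banach algebra is weakly amenable if every continuous derivation into its dual is inner. -/
def IsWeaklyAmenable : Prop :=
  ∀ D : A →L[ℂ] StrongDual ℂ A, (∀ a b, D (a * b) = dualLeft a (D b) + dualRight (D a) b) →
    ∃ φ : StrongDual ℂ A, ∀ a, D a = dualLeft a φ - dualRight φ a

end WeakAmenability

section Algebra
variable (G : Type*) [Group G] [TopologicalSpace G] [IsTopologicalGroup G] [LocallyCompactSpace G]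
  [T2Space G]

instance borelSpace_borel : @BorelSpace G _ (borel G) := @BorelSpace.mk G _ (borel G) rfl

/-- The left Haar measure on the Borel sets of `G`. -/
noncomputable def leftHaar : @Measure G (borel G) :=
  @Measure.haar G _ _ _ (borel G) (borelSpace_borel G) _

instance isHaarMeasure_leftHaar : @Measure.IsHaarMeasure G _ _ (borel G) (leftHaar G) := by
  let _ : MeasurableSpace G := borel G
  exact inferInstanceAs (Measure.haar : Measure G).IsHaarMeasure

instance regular_leftHaar : @Measure.Regular G (borel G) _ (leftHaar G) := by
  let _ : MeasurableSpace G := borel G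
  exact inferInstanceAs (Measure.haar : Measure G).Regular

variable {G}

/-- The Beurling algebra `L¹(G, ω)` of a locally compact group `G`. The Borel `σ`-algebra is used
explicitly, because on a product group it may differ from the product `σ`-algebra. -/
abbrev BeurlingAlgebra (ω : Weight G) : Type _ := @WeightedL1 G _ _ (borel G) (leftHaar G) ω

end Algebra
end Beurling

/-! Write the group as `C × A`. Integrating over `A` gives a homomorphism `T` from the algebra of
the product onto that of `C`, bounded because the weight on `A` is bounded below. Weak amenability
need not pass to quotients, but here `T` has a bounded linear section `J`, namely `f ↦ f ⊗ g` with
`∫ g = 1`. It is not multiplicative, yet `J a * J b = J' (a * b)` for the bounded linear map `J' : f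
↦ f ⊗ (g * g)`. For a derivation `D`, the pullback `T* ∘ D ∘ T` is a derivation on the product
algebra, hence implemented by some `Φ`. Evaluating it at `J a` and `J c` shows that `Φ ∘ J'`
implements `D`; this is `IsWeaklyAmenable.of_retract`.

The analysis is done on `C_c`, which is dense in each algebra. No σ-finiteness is assumed and the
Borel σ-algebra of a product may exceed the product σ-algebra, so Fubini comes from uniqueness of
Haar measure (`exists_integral_eq_iterated`), at the price of a constant `κ`. The algebra is in
`fiberIntegral_compactConvolution` and `compactConvolution_tensor`, the bounds in
`norm_toWeightedL1_fiberIntegral_le` and `norm_toWeightedL1_tensor`. -/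

namespace Beurling

open MeasureTheory Filter Topology
open scoped ENNReal NNReal CompactlySupported Pointwise

/-! ### Transfer of weak amenability along a split homomorphism -/

section Transfer
variable {A E : Type*} [NonUnitalNormedRing A] [NormedSpace ℂ A] [IsScalarTower ℂ A A]
  [SMulCommClass ℂ A A] [NonUnitalNormedRing E] [NormedSpace ℂ E] [IsScalarTower ℂ E E]
  [SMulCommClass ℂ E E]

/-- The section `J` only has to be multiplicative up to replacing it by another linear map `J'`:
commutators of elements `J a`, `J c` are then values of `J'` on commutators in `A`, which is all
that innerness sees. -/
theorem IsWeaklyAmenable.of_retract (h : IsWeaklyAmenable E) (T : E →L[ℂ] A)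
    (hT : ∀ x y, T (x * y) = T x * T y) (J J' : A →L[ℂ] E) (hTJ : ∀ a, T (J a) = a)
    (hJ : ∀ a b, J a * J b = J' (a * b)) : IsWeaklyAmenable A := by
  intro D hD
  -- The pulled-back map is `x ↦ D (T x) ∘ T`; multiplicativity of `T` makes it a derivation.
  obtain ⟨Φ, hΦ⟩ := h ((((ContinuousLinearMap.compL ℂ E A ℂ).flip T).comp D).comp T) fun x y => by
    ext z
    simp [hT, hD, dualLeft, dualRight]
  refine ⟨Φ.comp J', fun a => ?_⟩
  ext c
  -- At `J a` and `J c` the pullback returns `D a c`, as `T ∘ J = id`, while the inner derivation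
  -- gives `Φ (J c * J a) - Φ (J a * J c) = Φ (J' (c * a)) - Φ (J' (a * c))`.
  have := congrArg (fun φ : StrongDual ℂ E => φ (J c)) (hΦ (J a))
  simpa [hTJ, dualLeft, dualRight, hJ] using this

end Transfer

/-! ### Continuous compactly supported functions inside `L¹(G, ω)` -/

section Embedding
set_option linter.unusedSectionVars false
variable {G : Type*} [Group G] [TopologicalSpace G] [IsTopologicalGroup G] [LocallyCompactSpace G]
  [T2Space G] [MeasurableSpace G] [BorelSpace G]
  {μ : Measure G} [μ.IsHaarMeasure] [μ.Regular] {ω : Weight G}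

/-- The function `|f| ω`. -/
noncomputable def normWeight (ω : Weight G) (f : C_c(G, ℂ)) : C_c(G, ℝ) where
  toFun x := ‖f x‖ * ω x
  continuous_toFun := f.continuous.norm.mul ω.continuous_toFun
  hasCompactSupport' := f.hasCompactSupport.norm.mul_right

theorem normWeight_apply (f : C_c(G, ℂ)) (x : G) : normWeight ω f x = ‖f x‖ * ω x := rfl

theorem integrable_wMeasure (f : C_c(G, ℂ)) : Integrable f (wMeasure μ ω) := by
  refine ⟨f.continuous.aestronglyMeasurable, ?_⟩
  have h := (normWeight ω f).integrable (μ := μ) |>.2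
  unfold HasFiniteIntegral at h ⊢
  rw [lintegral_wMeasure ω.continuous_toFun]
  convert h using 3 with x
  rw [normWeight_apply, enorm_mul, enorm_norm, mul_comm, Real.enorm_eq_ofReal (ω.pos x).le]

variable (μ ω) in
/-- The map from the continuous compactly supported functions to `L¹(G, ω)`. -/
noncomputable def toWeightedL1 : C_c(G, ℂ) →ₗ[ℂ] WeightedL1 μ ω where
  toFun f := WeightedL1.mk f (integrable_wMeasure f)
  map_add' f g := by
    refine WeightedL1.ext ?_
    filter_upwards [WeightedL1.rep_mk (μ := μ) (ω := ω) _ (integrable_wMeasure f),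
      WeightedL1.rep_mk (μ := μ) (ω := ω) _ (integrable_wMeasure g),
      WeightedL1.rep_mk (μ := μ) (ω := ω) _ (integrable_wMeasure (f + g)),
      WeightedL1.rep_add (μ := μ) (ω := ω) (WeightedL1.mk f (integrable_wMeasure f))
        (WeightedL1.mk g (integrable_wMeasure g))] with x h1 h2 h3 h4
    rw [h3, h4, h1, h2]
    rfl
  map_smul' c f := by
    refine WeightedL1.ext ?_
    filter_upwards [WeightedL1.rep_mk (μ := μ) (ω := ω) _ (integrable_wMeasure f),
      WeightedL1.rep_mk (μ := μ) (ω := ω) _ (integrable_wMeasure (c • f)),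
      WeightedL1.rep_smul (μ := μ) (ω := ω) c (WeightedL1.mk f (integrable_wMeasure f))]
      with x h1 h2 h3
    rw [h2, RingHom.id_apply, h3, h1]
    rfl

theorem rep_toWeightedL1 (f : C_c(G, ℂ)) : (toWeightedL1 μ ω f).rep =ᵐ[μ] f :=
  WeightedL1.rep_mk _ (integrable_wMeasure f)

theorem norm_toWeightedL1 (f : C_c(G, ℂ)) : ‖toWeightedL1 μ ω f‖ = ∫ x, normWeight ω f x ∂μ := by
  rw [WeightedL1.norm_eq_integral]
  refine integral_congr_ae ?_
  filter_upwards [rep_toWeightedL1 (μ := μ) (ω := ω) f] with x hx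
  rw [hx, normWeight_apply]

/-- Density allows bounded maps between Beurling algebras to be defined, and identities between them
to be checked, on `C_c` alone. -/
theorem denseRange_toWeightedL1 : DenseRange (toWeightedL1 μ ω) := by
  refine WeightedL1.dense_compactlySupported.mono ?_
  rintro a ⟨f, hf, hf', ha⟩
  exact ⟨⟨⟨f, hf⟩, hf'⟩, WeightedL1.ext ((rep_toWeightedL1 _).trans ha.symm)⟩

variable (μ) in
/-- The convolution of continuous compactly supported functions. -/
noncomputable def compactConvolution (f g : C_c(G, ℂ)) : C_c(G, ℂ) where
  toFun := convolution μ f g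
  continuous_toFun := by
    rw [← continuousOn_univ]
    -- For every `x` the integrand vanishes for `y` outside the support of `f`, a compact set
    -- independent of `x`.
    refine continuousOn_integral_of_compact_support f.hasCompactSupport.isCompact
      (Continuous.continuousOn ?_) fun x y _ hy => by simp [image_eq_zero_of_notMem_tsupport hy]
    exact (f.continuous.comp continuous_snd).mul (g.continuous.comp (by fun_prop))
  hasCompactSupport' := by
    refine HasCompactSupport.intro
      (f.hasCompactSupport.isCompact.mul g.hasCompactSupport.isCompact) fun x hx => ?_
    refine integral_eq_zero_of_ae (Eventually.of_forall fun y => ?_)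
    by_contra h
    exact hx ⟨y, subset_tsupport _ (left_ne_zero_of_mul h), y⁻¹ * x,
      subset_tsupport _ (right_ne_zero_of_mul h), by simp⟩

theorem compactConvolution_apply (f g : C_c(G, ℂ)) (x : G) :
    compactConvolution μ f g x = ∫ y, f y * g (y⁻¹ * x) ∂μ := rfl

theorem toWeightedL1_mul (f g : C_c(G, ℂ)) :
    toWeightedL1 μ ω f * toWeightedL1 μ ω g = toWeightedL1 μ ω (compactConvolution μ f g) := by
  refine WeightedL1.ext ?_
  have h := convolution_congr ω.continuous_toFun ω.pos
    (WeightedL1.integrable_rep (toWeightedL1 μ ω f)) (WeightedL1.integrable_rep _)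
    (rep_toWeightedL1 f) (rep_toWeightedL1 (μ := μ) (ω := ω) g)
  filter_upwards [WeightedL1.rep_mul (toWeightedL1 μ ω f) (toWeightedL1 μ ω g),
    rep_toWeightedL1 (μ := μ) (ω := ω) (compactConvolution μ f g)] with x h1 h2
  rw [h1, h2, h]
  rfl

end Embedding

/-! ### Integration over a factor of a product group -/

section Product
set_option linter.unusedSectionVars false
variable {A C H : Type*}
  [Group A] [TopologicalSpace A] [IsTopologicalGroup A] [LocallyCompactSpace A] [T2Space A]
  [MeasurableSpace A] [BorelSpace A]
  [Group C] [TopologicalSpace C] [IsTopologicalGroup C] [LocallyCompactSpace C] [T2Space C]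
  [MeasurableSpace C] [BorelSpace C]
  [Group H] [TopologicalSpace H] [IsTopologicalGroup H] [LocallyCompactSpace H] [T2Space H]
  [MeasurableSpace H] [BorelSpace H]
  (e : H ≃ₜ* C × A)
  (α : Measure A) [α.IsHaarMeasure] [α.Regular] (γ : Measure C) [γ.IsHaarMeasure] [γ.Regular]
  (μ : Measure H) [μ.IsHaarMeasure] [μ.Regular]

/-- The embedding of the second factor. -/
noncomputable def prodInr : A →* H where
  toFun y := e.symm (1, y)
  map_one' := map_one e.symm
  map_mul' y y' := by simp [← map_mul]

/-- The projection to the first factor. -/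
noncomputable def prodFst : H →* C where
  toFun h := (e h).1
  map_one' := by simp
  map_mul' h h' := by simp

theorem prodInr_apply (y : A) : prodInr e y = e.symm (1, y) := rfl

theorem prodFst_apply (h : H) : prodFst e h = (e h).1 := rfl

/-- Viewing the product as an extension of `C` by `A` makes available integration over cosets as a
map on `C_c`, and the Haar measure induced from those of `A` and `C`. -/
theorem isSES_of_prod : TopologicalGroup.IsSES (prodInr e) (prodFst e) where
  -- The second coordinate is a continuous left inverse.
  isClosedEmbedding := Function.LeftInverse.isClosedEmbedding (f := fun h => (e h).2)
    (fun y => by simp [prodInr_apply]) (continuous_snd.comp e.continuous)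
    (e.symm.continuous.comp (by fun_prop))
  isOpenQuotientMap := isOpenQuotientMap_fst.comp e.toHomeomorph.isOpenQuotientMap
  mulExact h := by
    constructor
    · intro hh
      exact ⟨(e h).2, e.injective (by simpa [Prod.ext_iff, prodInr_apply, prodFst_apply] using hh.symm)⟩
    · rintro ⟨y, rfl⟩
      simp [prodFst_apply, prodInr_apply]

/-- Integration over the second factor. -/
noncomputable def fiberIntegral : C_c(H, ℂ) →ₗ[ℂ] C_c(C, ℂ) where
  toFun f := (isSES_of_prod e).pushforward α f
  map_add' := map_add _
  map_smul' c f := by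
    ext x
    -- The pushforward at `x` is the integral of the pullback along a chosen preimage of `x`.
    exact integral_smul c ((isSES_of_prod e).pullback f (Function.invFun (prodFst e) x))

theorem pushforward_prod_apply {E : Type*} [NormedAddCommGroup E] [NormedSpace ℝ E]
    (f : C_c(H, E)) (x : C) :
    (isSES_of_prod e).pushforward α f x = ∫ y, f (e.symm (x, y)) ∂α := by
  have := (isSES_of_prod e).pushforward_apply_apply α f (e.symm (x, 1))
  simpa [TopologicalGroup.IsSES.pullback_def, prodInr_apply, prodFst_apply, ← map_mul] using this

theorem fiberIntegral_apply (f : C_c(H, ℂ)) (x : C) :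
    fiberIntegral e α f x = ∫ y, f (e.symm (x, y)) ∂α :=
  pushforward_prod_apply e α f x

theorem integrable_slice {E : Type*} [NormedAddCommGroup E] (f : C_c(H, E)) (x : C) :
    Integrable (fun y => f (e.symm (x, y))) α := by
  have := ((isSES_of_prod e).pullback f (e.symm (x, 1))).integrable (μ := α)
  refine this.congr (Eventually.of_forall fun y => ?_)
  simp [TopologicalGroup.IsSES.pullback_def, prodInr_apply, ← map_mul]

/-- The iterated integral on `C_c` is integration against the induced measure on `H`, a regular Haar
measure, so uniqueness gives proportionality to `μ`. The real form serves norms, the complex form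
convolutions. -/
theorem exists_integral_eq_iterated : ∃ κ : ℝ, 0 < κ ∧
    (∀ f : C_c(H, ℝ), ∫ h, f h ∂μ = κ * ∫ x, ∫ y, f (e.symm (x, y)) ∂α ∂γ) ∧
    (∀ f : C_c(H, ℂ), ∫ h, f h ∂μ = κ * ∫ x, ∫ y, f (e.symm (x, y)) ∂α ∂γ) := by
  let ν := (isSES_of_prod e).inducedMeasure α γ
  have hμ : μ = Measure.haarScalarFactor μ ν • ν := Measure.isMulLeftInvariant_eq_smul_of_regular μ ν
  have hr (f : C_c(H, ℝ)) : ∫ h, f h ∂μ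
      = Measure.haarScalarFactor μ ν * ∫ x, ∫ y, f (e.symm (x, y)) ∂α ∂γ := by
    calc ∫ h, f h ∂μ = ∫ h, f h ∂(Measure.haarScalarFactor μ ν • ν) :=
          congrArg (fun m => ∫ h, f h ∂m) hμ
      _ = Measure.haarScalarFactor μ ν * ∫ x, (isSES_of_prod e).pushforward α f x ∂γ := by
          rw [integral_smul_nnreal_measure, NNReal.smul_def, smul_eq_mul,
            TopologicalGroup.IsSES.integral_inducedMeasure, TopologicalGroup.IsSES.integrate_apply]
      _ = _ := by simp_rw [pushforward_prod_apply]
  refine ⟨Measure.haarScalarFactor μ ν,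
    NNReal.coe_pos.2 (Measure.haarScalarFactor_pos_of_isHaarMeasure μ ν), hr, fun f => ?_⟩
  -- The induced measure is described by a functional on real functions, so the complex case goes
  -- through real and imaginary parts.
  let u : C_c(H, ℝ) := f.compLeft ⟨Complex.re, Complex.continuous_re⟩
  let v : C_c(H, ℝ) := f.compLeft ⟨Complex.im, Complex.continuous_im⟩
  have hu : ∀ h, u h = (f h).re := CompactlySupportedContinuousMap.compLeft_apply rfl f
  have hv : ∀ h, v h = (f h).im := CompactlySupportedContinuousMap.compLeft_apply rfl f
  have hi := f.integrable (μ := μ)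
  have hP := (fiberIntegral e α f).integrable (μ := γ)
  simp_rw [← fiberIntegral_apply]
  rw [← integral_re_add_im hi, ← integral_re_add_im hP]
  have h1 := hr u
  have h2 := hr v
  have hx : ∀ x, ∫ y, u (e.symm (x, y)) ∂α = RCLike.re (fiberIntegral e α f x) := fun x => by
    rw [fiberIntegral_apply, ← integral_re (integrable_slice e α f x)]
    simp [hu]
  have hy : ∀ x, ∫ y, v (e.symm (x, y)) ∂α = RCLike.im (fiberIntegral e α f x) := fun x => by
    rw [fiberIntegral_apply, ← integral_im (integrable_slice e α f x)]
    simp [hv]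
  simp_rw [hx] at h1
  simp_rw [hy] at h2
  simp only [hu, hv] at h1 h2
  simp only [RCLike.re_to_complex, RCLike.im_to_complex] at h1 h2 ⊢
  rw [h1, h2]
  simp only [RCLike.ofReal_mul, mul_add, mul_assoc]
  rfl

/-! ### Tensors, fibre integrals and convolution -/

/-- The function `h ↦ f(x) g(y)` for `h` corresponding to `(x, y)`. -/
noncomputable def tensor (g : C_c(A, ℂ)) : C_c(C, ℂ) →ₗ[ℂ] C_c(H, ℂ) where
  toFun f :=
    { toFun := fun h => f (e h).1 * g (e h).2
      continuous_toFun := by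
        have := e.continuous
        fun_prop
      hasCompactSupport' := by
        refine HasCompactSupport.intro ((f.hasCompactSupport.isCompact.prod
          g.hasCompactSupport.isCompact).image e.symm.continuous) fun h hh => ?_
        by_contra h0
        exact hh ⟨e h, ⟨subset_tsupport _ (left_ne_zero_of_mul h0),
          subset_tsupport _ (right_ne_zero_of_mul h0)⟩, e.symm_apply_apply h⟩ }
  map_add' f f' := by
    ext h
    exact add_mul _ _ _
  map_smul' c f := by
    ext h
    exact mul_assoc _ _ _

theorem tensor_apply (g : C_c(A, ℂ)) (f : C_c(C, ℂ)) (h : H) :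
    tensor e g f h = f (e h).1 * g (e h).2 := rfl

theorem fiberIntegral_tensor (g : C_c(A, ℂ)) (f : C_c(C, ℂ)) :
    fiberIntegral e α (tensor e g f) = (∫ y, g y ∂α) • f := by
  ext x
  rw [fiberIntegral_apply]
  simp [tensor_apply, integral_const_mul, mul_comm (∫ y, g y ∂α)]

variable {e α γ μ} {κ : ℝ}

/-- The integrand of the convolution splits into a function of `x` times a function of `y`; `κ` is
the normalisation of `μ` against the iterated integral. -/
theorem compactConvolution_tensor
    (hκ : ∀ f : C_c(H, ℂ), ∫ h, f h ∂μ = κ * ∫ x, ∫ y, f (e.symm (x, y)) ∂α ∂γ)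
    (g g' : C_c(A, ℂ)) (f f' : C_c(C, ℂ)) :
    compactConvolution μ (tensor e g f) (tensor e g' f') =
      (κ : ℂ) • tensor e (compactConvolution α g g') (compactConvolution γ f f') := by
  ext h
  let F : C_c(H, ℂ) :=
    { toFun := fun k => tensor e g f k * tensor e g' f' (k⁻¹ * h)
      continuous_toFun := by fun_prop
      hasCompactSupport' := (tensor e g f).hasCompactSupport.mul_right }
  have := hκ F
  rw [compactConvolution_apply]
  refine this.trans ?_
  simp only [CompactlySupportedContinuousMap.smul_apply, smul_eq_mul, tensor_apply,
    compactConvolution_apply]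
  congr 1
  rw [← integral_mul_const]
  refine integral_congr_ae (Eventually.of_forall fun x => ?_)
  simp only
  rw [← integral_const_mul]
  refine integral_congr_ae (Eventually.of_forall fun y => ?_)
  change tensor e g f _ * tensor e g' f' _ = _
  simp [tensor_apply]
  ring

/-- After exchanging the integrals over `A` and `H`, left invariance of `α` removes the
`A`-coordinate of `k` from the translate of `F'`, leaving its fibre integral at `(e k).1⁻¹ * x`. -/
theorem fiberIntegral_compactConvolution
    (hκ : ∀ f : C_c(H, ℂ), ∫ h, f h ∂μ = κ * ∫ x, ∫ y, f (e.symm (x, y)) ∂α ∂γ)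
    (F F' : C_c(H, ℂ)) :
    fiberIntegral e α (compactConvolution μ F F') =
      (κ : ℂ) • compactConvolution γ (fiberIntegral e α F) (fiberIntegral e α F') := by
  ext x
  -- What remains to be integrated over `H` once the `A`-integral is done; it lies in `C_c(H, ℂ)`,
  -- so `hκ` applies.
  let P : C_c(H, ℂ) :=
    { toFun := fun k => F k * fiberIntegral e α F' ((e k).1⁻¹ * x)
      continuous_toFun := by
        have := e.continuous
        fun_prop
      hasCompactSupport' := F.hasCompactSupport.mul_right }
  have hP := hκ P
  have hinner : ∀ k, ∫ y, F k * F' (k⁻¹ * e.symm (x, y)) ∂α = P k := by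
    intro k
    change _ = F k * fiberIntegral e α F' ((e k).1⁻¹ * x)
    rw [integral_const_mul, fiberIntegral_apply, ← integral_mul_left_eq_self
      (fun y => F' (e.symm ((e k).1⁻¹ * x, y))) (e k).2⁻¹]
    congr 2
    ext y
    congr 1
    apply e.injective
    ext <;> simp
  rw [fiberIntegral_apply]
  simp only [compactConvolution_apply]
  rw [integral_integral_swap_of_hasCompactSupport]
  · simp_rw [hinner, hP]
    simp only [CompactlySupportedContinuousMap.smul_apply, smul_eq_mul, compactConvolution_apply]
    congr 1
    refine integral_congr_ae (Eventually.of_forall fun s => ?_)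
    simp only
    rw [fiberIntegral_apply e α F, ← integral_mul_const]
    refine integral_congr_ae (Eventually.of_forall fun t => ?_)
    change F _ * fiberIntegral e α F' _ = _
    simp
  · have := e.symm.continuous
    simp only [Function.uncurry_def]
    fun_prop
  · have hK := (((F.hasCompactSupport.isCompact.mul F'.hasCompactSupport.isCompact).image
      (continuous_snd.comp e.continuous)).prod F.hasCompactSupport.isCompact)
    refine HasCompactSupport.intro hK fun p hp => ?_
    by_contra h0
    have h1 := subset_tsupport _ (left_ne_zero_of_mul h0 : F p.2 ≠ 0)
    have h2 := subset_tsupport _ (right_ne_zero_of_mul h0 : F' (p.2⁻¹ * e.symm (x, p.1)) ≠ 0)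
    exact hp ⟨⟨e.symm (x, p.1), ⟨_, h1, _, h2, by simp⟩,
      congrArg Prod.snd (e.apply_symm_apply (x, p.1))⟩, h1⟩

/-! ### Norm estimates and the retraction -/

variable {ω : Weight H} {ω₁ : Weight C} {ω₂ : Weight A}

theorem norm_toWeightedL1_tensor
    (hκ : ∀ f : C_c(H, ℝ), ∫ h, f h ∂μ = κ * ∫ x, ∫ y, f (e.symm (x, y)) ∂α ∂γ)
    (hω : ∀ h, ω h = ω₁ (e h).1 * ω₂ (e h).2) (g : C_c(A, ℂ)) (f : C_c(C, ℂ)) :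
    ‖toWeightedL1 μ ω (tensor e g f)‖ =
      κ * ‖toWeightedL1 α ω₂ g‖ * ‖toWeightedL1 γ ω₁ f‖ := by
  simp only [norm_toWeightedL1, hκ]
  rw [mul_assoc]
  congr 1
  rw [← integral_const_mul]
  refine integral_congr_ae (Eventually.of_forall fun x => ?_)
  simp only
  rw [← integral_mul_const]
  refine integral_congr_ae (Eventually.of_forall fun y => ?_)
  simp only [normWeight_apply, tensor_apply, hω, ContinuousMulEquiv.apply_symm_apply, norm_mul]
  ring

/-- The lower bound on `ω₂` enters here: `ω₁ x ≤ δ⁻¹ * ω₁ x * ω₂ y`, so the fibre integral of `|F|`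
times `ω₁` is dominated by that of `|F| ω`. -/
theorem norm_toWeightedL1_fiberIntegral_le (hκ0 : 0 < κ)
    (hκ : ∀ f : C_c(H, ℝ), ∫ h, f h ∂μ = κ * ∫ x, ∫ y, f (e.symm (x, y)) ∂α ∂γ)
    (hω : ∀ h, ω h = ω₁ (e h).1 * ω₂ (e h).2) {δ : ℝ} (hδ : 0 < δ) (hω₂ : ∀ y, δ ≤ ω₂ y)
    (F : C_c(H, ℂ)) :
    ‖toWeightedL1 γ ω₁ (fiberIntegral e α F)‖ ≤ (κ * δ)⁻¹ * ‖toWeightedL1 μ ω F‖ := by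
  have key : ∀ x, normWeight ω₁ (fiberIntegral e α F) x
      ≤ δ⁻¹ * (isSES_of_prod e).pushforward α (normWeight ω F) x := by
    intro x
    rw [pushforward_prod_apply, normWeight_apply, fiberIntegral_apply]
    calc ‖∫ y, F (e.symm (x, y)) ∂α‖ * ω₁ x
        ≤ (∫ y, ‖F (e.symm (x, y))‖ ∂α) * ω₁ x :=
          mul_le_mul_of_nonneg_right (norm_integral_le_integral_norm _) (ω₁.pos x).le
      _ = ∫ y, ‖F (e.symm (x, y))‖ * ω₁ x ∂α := (integral_mul_const _ _).symm
      _ ≤ ∫ y, δ⁻¹ * normWeight ω F (e.symm (x, y)) ∂α := by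
          refine integral_mono ((integrable_slice e α F x).norm.mul_const _)
            ((integrable_slice e α (normWeight ω F) x).const_mul _) fun y => ?_
          simp only [normWeight_apply, hω, ContinuousMulEquiv.apply_symm_apply]
          rw [le_inv_mul_iff₀ hδ]
          calc δ * (‖F (e.symm (x, y))‖ * ω₁ x) ≤ ω₂ y * (‖F (e.symm (x, y))‖ * ω₁ x) :=
                mul_le_mul_of_nonneg_right (hω₂ y) (mul_nonneg (norm_nonneg _) (ω₁.pos x).le)
            _ = _ := by ring
      _ = _ := integral_const_mul _ _
  rw [norm_toWeightedL1, norm_toWeightedL1, hκ]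
  calc ∫ x, normWeight ω₁ (fiberIntegral e α F) x ∂γ
      ≤ ∫ x, δ⁻¹ * (isSES_of_prod e).pushforward α (normWeight ω F) x ∂γ :=
        integral_mono (normWeight ω₁ (fiberIntegral e α F)).integrable
          (((isSES_of_prod e).pushforward α (normWeight ω F)).integrable.const_mul _) key
    _ = (κ * δ)⁻¹ * (κ * ∫ x, ∫ y, normWeight ω F (e.symm (x, y)) ∂α ∂γ) := by
        rw [integral_const_mul]
        simp_rw [pushforward_prod_apply]
        field_simp

theorem exists_integral_eq_one : ∃ g : C_c(A, ℂ), ∫ y, g y ∂α = 1 := by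
  obtain ⟨f, hf, hf0, hf1⟩ :
    ∃ f : C(A, ℝ), HasCompactSupport f ∧ 0 ≤ f ∧ f 1 ≠ 0 := exists_continuous_nonneg_pos 1
  have hne : ∫ x, f x ∂α ≠ 0 :=
    (f.continuous.integral_pos_of_hasCompactSupport_nonneg_nonzero hf hf0 hf1).ne'
  refine ⟨⟨⟨fun y => ((f y * (∫ x, f x ∂α)⁻¹ : ℝ) : ℂ), by fun_prop⟩,
    (hf.mul_right (f' := fun _ => (∫ x, f x ∂α)⁻¹)).comp_left Complex.ofReal_zero⟩, ?_⟩
  change ∫ y, ((f y * (∫ x, f x ∂α)⁻¹ : ℝ) : ℂ) ∂α = 1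
  rw [integral_complex_ofReal, integral_mul_const, mul_inv_cancel₀ hne, Complex.ofReal_one]

/-- An arbitrary isomorphism `e` is allowed so that either factor can play the role of `C`. -/
theorem IsWeaklyAmenable.of_prod (e : H ≃ₜ* C × A) (hω : ∀ h, ω h = ω₁ (e h).1 * ω₂ (e h).2)
    (hω₂ : ω₂.BoundedAwayFromZero) (h : IsWeaklyAmenable (WeightedL1 μ ω)) :
    IsWeaklyAmenable (WeightedL1 γ ω₁) := by
  obtain ⟨α, _, _⟩ : ∃ α : Measure A, α.IsHaarMeasure ∧ α.Regular :=
    ⟨Measure.haar, inferInstance, inferInstance⟩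
  obtain ⟨κ, hκ0, hκr, hκ⟩ := exists_integral_eq_iterated e α γ μ
  obtain ⟨δ, hδ, hω₂⟩ := hω₂
  obtain ⟨g, hg⟩ := exists_integral_eq_one (α := α)
  have hκc : (κ : ℂ) ≠ 0 := Complex.ofReal_ne_zero.2 hκ0.ne'
  have hd := denseRange_toWeightedL1 (μ := μ) (ω := ω)
  have hd₁ := denseRange_toWeightedL1 (μ := γ) (ω := ω₁)
  -- The fibre integral is multiplicative only up to the factor `κ`; scaling it by `κ` makes it a
  -- homomorphism.
  let T₀ := (toWeightedL1 γ ω₁).comp ((κ : ℂ) • fiberIntegral e α)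
  have hT₀ : ∃ c, ∀ F, ‖T₀ F‖ ≤ c * ‖toWeightedL1 μ ω F‖ := by
    refine ⟨κ * (κ * δ)⁻¹, fun F => ?_⟩
    have := norm_toWeightedL1_fiberIntegral_le hκ0 hκr hω hδ hω₂ F
    simp only [T₀, LinearMap.comp_apply, LinearMap.smul_apply, map_smul, norm_smul,
      Complex.norm_real, Real.norm_of_nonneg hκ0.le, mul_assoc]
    simpa [mul_assoc] using mul_le_mul_of_nonneg_left this hκ0.le
  have hJ₀ (c : ℂ) (b : C_c(A, ℂ)) : ∃ B, ∀ f,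
      ‖(toWeightedL1 μ ω).comp (c • tensor e b) f‖ ≤ B * ‖toWeightedL1 γ ω₁ f‖ := by
    refine ⟨‖c‖ * (κ * ‖toWeightedL1 α ω₂ b‖), fun f => ?_⟩
    simp only [LinearMap.comp_apply, LinearMap.smul_apply, map_smul, norm_smul,
      norm_toWeightedL1_tensor hκr hω, mul_assoc]
    exact le_rfl
  let T := T₀.extendOfNorm (toWeightedL1 μ ω)
  have hT (F : C_c(H, ℂ)) : T (toWeightedL1 μ ω F)
      = toWeightedL1 γ ω₁ ((κ : ℂ) • fiberIntegral e α F) :=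
    LinearMap.extendOfNorm_eq hd hT₀ F
  let J (c : ℂ) (b : C_c(A, ℂ)) : WeightedL1 γ ω₁ →L[ℂ] WeightedL1 μ ω :=
    ((toWeightedL1 μ ω).comp (c • tensor e b)).extendOfNorm (toWeightedL1 γ ω₁)
  have hJ (c : ℂ) (b : C_c(A, ℂ)) (f : C_c(C, ℂ)) :
      J c b (toWeightedL1 γ ω₁ f) = toWeightedL1 μ ω (c • tensor e b f) :=
    LinearMap.extendOfNorm_eq hd₁ (hJ₀ c b) f
  -- The factor `κ⁻¹` compensates the `κ` in `T`. It also fits the product formula: `κ⁻¹ • (f ⊗ g)`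
  -- times `κ⁻¹ • (f' ⊗ g)` is `κ⁻² κ = κ⁻¹` times `(f * f') ⊗ (g * g)`.
  refine h.of_retract T ?_ (J (κ : ℂ)⁻¹ g) (J (κ : ℂ)⁻¹ (compactConvolution α g g)) ?_ ?_
  · refine fun x y => hd.induction_on₂ (p := fun x y => T (x * y) = T x * T y)
      (isClosed_eq (by fun_prop) (by fun_prop)) (fun F F' => ?_) x y
    rw [toWeightedL1_mul, hT, hT, hT, fiberIntegral_compactConvolution hκ]
    simp only [map_smul, ← toWeightedL1_mul, smul_mul_assoc, mul_smul_comm]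
  · refine fun x => hd₁.induction_on (p := fun x => T (J (κ : ℂ)⁻¹ g x) = x) x
      (isClosed_eq (by fun_prop) (by fun_prop)) (fun f => ?_)
    rw [hJ, hT, map_smul (fiberIntegral e α), smul_inv_smul₀ hκc, fiberIntegral_tensor, hg, one_smul]
  · refine fun x y => hd₁.induction_on₂
      (p := fun x y => J (κ : ℂ)⁻¹ g x * J (κ : ℂ)⁻¹ g y
        = J (κ : ℂ)⁻¹ (compactConvolution α g g) (x * y))
      (isClosed_eq (by fun_prop) (by fun_prop)) (fun f f' => ?_) x y
    rw [toWeightedL1_mul, hJ, hJ, hJ]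
    simp only [map_smul, smul_mul_assoc, mul_smul_comm, toWeightedL1_mul,
      compactConvolution_tensor hκ, inv_smul_smul₀ hκc]

end Product
end Beurling

/-! ### The theorem for both factors -/

theorem mainTheorem9 {G₁ : Type*} [Group G₁] [TopologicalSpace G₁] [IsTopologicalGroup G₁]
    [LocallyCompactSpace G₁] [T2Space G₁] {G₂ : Type*} [Group G₂] [TopologicalSpace G₂]
    [IsTopologicalGroup G₂] [LocallyCompactSpace G₂] [T2Space G₂]
    (ω₁ : Beurling.Weight G₁) (ω₂ : Beurling.Weight G₂)
    (h₁ : ω₁.BoundedAwayFromZero) (h₂ : ω₂.BoundedAwayFromZero)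
    (h : Beurling.IsWeaklyAmenable (Beurling.BeurlingAlgebra (ω₁.prod ω₂))) :
    Beurling.IsWeaklyAmenable (Beurling.BeurlingAlgebra ω₁) ∧
      Beurling.IsWeaklyAmenable (Beurling.BeurlingAlgebra ω₂) := by
  -- These are the structures built into `BeurlingAlgebra`; on `G₁ × G₂` it is the Borel σ-algebra
  -- of the product topology, not the product σ-algebra.
  let _ : MeasurableSpace G₁ := borel G₁
  let _ : MeasurableSpace G₂ := borel G₂
  let _ : MeasurableSpace (G₁ × G₂) := borel (G₁ × G₂)
  have : BorelSpace G₁ := ⟨rfl⟩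
  have : BorelSpace G₂ := ⟨rfl⟩
  have : BorelSpace (G₁ × G₂) := ⟨rfl⟩
  exact ⟨Beurling.IsWeaklyAmenable.of_prod (ContinuousMulEquiv.refl (G₁ × G₂))
      (fun _ => rfl) h₂ h,
    -- Swapping coordinates makes `G₁` the factor that is integrated out, so the lower bound on `ω₁`
    -- is the one needed.
    Beurling.IsWeaklyAmenable.of_prod 
      { MulEquiv.prodComm (M := G₁) (N := G₂) with
        continuous_toFun := continuous_swap
        continuous_invFun := continuous_swap }
      (fun _ => mul_comm _ _) h₁ h⟩
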